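/- Let $K$ be a convex shape in the plane, that is, a compact convex subset of the Euclidean plane with non-empty interior, and let $\operatorname{per} K$ denote the length of its boundary $\partial K$. Then there exist four distinct points on $\partial K$ such that every path passing through all four of them has length at least $\frac12 \operatorname{per} K$. More precisely, $K$ has a diameter (a segment $ab$ with $a, b \in K$ whose length is the largest distance between two points of $K$), and for every diameter $ab$ of $K$ the following holds: $a, b \in \partial K$; the perpendicular bisector of $ab$ meets $\partial K$ in exactly two points $c \neq d$; the points $a, b, c, d$ are pairwise distinct; and every path (continuous image of a closed interval) passing through $a$, $b$, $c$ and $d$, in any order, has length at least $\frac12 \operatorname{per} K$. -/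

import Mathlib

open scoped MeasureTheory ENNReal

noncomputable section

/-- The Euclidean plane. -/
abbrev EuclPlane : Type := EuclideanSpace ℝ (Fin 2)

/-- A convex shape: a compact convex subset of the plane with non-empty interior. -/
structure IsConvexShape (K : Set EuclPlane) : Prop where
  isCompact : IsCompact K
  convex : Convex ℝ K
  nonempty_interior : (interior K).Nonempty

/-- The perimeter of `K`: the length (one-dimensional Hausdorff measure for the Euclidean
distance, normalized so that a segment has its usual length) of the boundary of `K`. -/
def perimeter (K : Set EuclPlane) : ℝ≥0∞ := μH[1] (frontier K)

/-- The length of a path: the supremum of the lengths of its inscribed polygonal lines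
(infinite if the path is not rectifiable). -/
def pathLength (γ : C(unitInterval, EuclPlane)) : ℝ≥0∞ := eVariationOn γ Set.univ

/-- The segment `ab` is a diameter of `K`: its endpoints are points of `K` at the largest
distance. -/
def IsDiameterOf (K : Set EuclPlane) (a b : EuclPlane) : Prop :=
  a ∈ K ∧ b ∈ K ∧ dist a b = Metric.diam K

end

/-! Place the diameter at a = (-r, 0), b = (r, 0), with c = (0, h) and d = (0, -k). Put p = |ac| =
|bc|, q = |ad| = |bd|, s = |cd|; all are at most |ab| = 2r. A path is at least as long as the
polygonal line through the four points in order of visit, and every such line has length at least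
one of p + q + s, 2p + q, p + 2q (`le_eVariationOn_of_kite`).

Half the perimeter is at most p + q + s: K lies in the trapezoid cut from the strip |x| ≤ r by
supporting lines at c and d (`IsConvexShape.perimeter_le_trapezoid`). This also settles 2p + q if s
≤ p. If p ≤ s, then 2p + q exceeds half the perimeter of a circumscribed equiangular octagon
(`IsConvexShape.perimeter_le_diam`, `octagon_le_kite`); p + 2q is symmetric.

Both perimeter bounds rest on `Convex.hausdorffMeasure_frontier_le`: nearest-point projection onto K
is 1-Lipschitz and maps the outer boundary onto a set containing that of K. -/

/-! ### Nearest-point projection and monotonicity of perimeter -/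

section Projection

variable {E : Type*} [NormedAddCommGroup E] [InnerProductSpace ℝ E]

/-- Every boundary point of a convex body has a non-zero outer normal vector. -/
theorem Convex.exists_outer_normal [CompleteSpace E] {K : Set E} (hK : Convex ℝ K)
    (hne : (interior K).Nonempty) {x : E} (hx : x ∈ frontier K) :
    ∃ ν : E, (∀ z ∈ K, inner ℝ ν z ≤ inner ℝ ν x) ∧
      ∀ z ∈ interior K, inner ℝ ν z < inner ℝ ν x := by
  obtain ⟨f, hf⟩ := geometric_hahn_banach_open_point hK.interior isOpen_interior hx.2
  refine ⟨(InnerProductSpace.toDual ℝ E).symm f, fun z hz => ?_, fun z hz => ?_⟩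
  · simp only [InnerProductSpace.toDual_symm_apply]
    have hz' : z ∈ closure (interior K) := by
      rw [hK.closure_interior_eq_closure_of_nonempty_interior hne]
      exact subset_closure hz
    exact closure_minimal (fun w hw => (hf w hw).le)
      (isClosed_le f.continuous continuous_const) hz'
  · simpa only [InnerProductSpace.toDual_symm_apply] using hf z hz

/-- A complete convex set has a nearest-point map, characterised by its obtuse angle property. -/
theorem Convex.exists_nearest_point_map {K : Set E} (hK : Convex ℝ K) (hc : IsComplete K)
    (hne : K.Nonempty) :
    ∃ g : E → E, ∀ w, g w ∈ K ∧ ∀ z ∈ K, inner ℝ (w - g w) (z - g w) ≤ 0 := by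
  choose g hg h using exists_norm_eq_iInf_of_complete_convex hne hc hK
  exact ⟨g, fun w => ⟨hg w, (norm_eq_iInf_iff_real_inner_le_zero hK (hg w)).1 (h w)⟩⟩

/-- Adding the obtuse angle conditions at the two image points bounds ‖g v - g w‖² by ⟨v - w, g v -
g w⟩; Cauchy–Schwarz finishes. -/
theorem lipschitzWith_one_of_obtuse {K : Set E} {g : E → E}
    (hg : ∀ w, g w ∈ K ∧ ∀ z ∈ K, inner ℝ (w - g w) (z - g w) ≤ 0) : LipschitzWith 1 g := by
  refine LipschitzWith.of_dist_le_mul fun v w => ?_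
  simp only [NNReal.coe_one, one_mul, dist_eq_norm]
  have h1 := (hg v).2 _ (hg w).1
  have h2 := (hg w).2 _ (hg v).1
  have h3 : ‖g v - g w‖ ^ 2 ≤ inner ℝ (v - w) (g v - g w) := by
    rw [← real_inner_self_eq_norm_sq]
    have : inner ℝ (v - w) (g v - g w) - inner ℝ (g v - g w) (g v - g w)
        = -inner ℝ (v - g v) (g w - g v) - inner ℝ (w - g w) (g v - g w) := by
      simp only [inner_sub_left, inner_sub_right]; ring
    linarith
  have h4 := real_inner_le_norm (v - w) (g v - g w)
  by_contra! h
  have : 0 ≤ ‖v - w‖ := norm_nonneg _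
  nlinarith

theorem eq_of_obtuse {w x y : E} (h1 : inner ℝ (w - x) (y - x) ≤ 0)
    (h2 : inner ℝ (w - y) (x - y) ≤ 0) : x = y := by
  have : inner ℝ (x - y) (x - y) = inner ℝ (w - x) (y - x) + inner ℝ (w - y) (x - y) := by
    simp only [inner_sub_left, inner_sub_right]; ring
  have h3 : inner ℝ (x - y) (x - y) ≤ 0 := by linarith
  exact sub_eq_zero.1 (real_inner_self_nonpos.1 h3)

/-- A ray that starts in a bounded closed set leaves it through a point outside of any given
open subset. -/
theorem exists_ray_mem_diff {P U : Set E} (hP : IsClosed P) (hb : Bornology.IsBounded P)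
    (hU : IsOpen U) (hUP : U ⊆ P) {x ν : E} (hx : x ∈ P) (hν : ν ≠ 0) :
    ∃ t : ℝ, 0 ≤ t ∧ x + t • ν ∈ P \ U := by
  have hν' : 0 < ‖ν‖ := norm_pos_iff.2 hν
  set T : Set ℝ := Set.Ici 0 ∩ (fun t : ℝ => x + t • ν) ⁻¹' P with hT
  have hcont : Continuous fun t : ℝ => x + t • ν := by fun_prop
  have hTclosed : IsClosed T := isClosed_Ici.inter (hP.preimage hcont)
  obtain ⟨R, hR⟩ := hb.exists_norm_le
  have hTb : T ⊆ Set.Icc 0 ((R + ‖x‖) / ‖ν‖) := by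
    rintro t ⟨ht0, ht⟩
    refine ⟨ht0, (le_div_iff₀ hν').2 ?_⟩
    have h1 := hR _ ht
    have h2 : ‖t • ν‖ = t * ‖ν‖ := by rw [norm_smul, Real.norm_of_nonneg ht0]
    have h3 : ‖t • ν‖ ≤ ‖x + t • ν‖ + ‖x‖ := by
      simpa using norm_sub_le (x + t • ν) x
    linarith
  have hTc : IsCompact T := isCompact_Icc.of_isClosed_subset hTclosed hTb
  -- Take the last parameter in P: if its point were in the open set U ⊆ P, the ray would stay in P
  -- a little longer.
  obtain ⟨t, ⟨ht0, htP⟩, htmax⟩ := hTc.exists_isMaxOn ⟨0, by simp [hT, hx]⟩ continuousOn_id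
  refine ⟨t, ht0, htP, fun htU => ?_⟩
  have hnhds : (fun t : ℝ => x + t • ν) ⁻¹' U ∈ nhds t := (hU.preimage hcont).mem_nhds htU
  obtain ⟨ε, hε, hball⟩ := Metric.mem_nhds_iff.1 hnhds
  have hmem : t + ε / 2 ∈ Metric.ball t ε := by
    rw [Metric.mem_ball, Real.dist_eq, add_sub_cancel_left, abs_of_pos (half_pos hε)]
    linarith
  have ht0' : 0 ≤ t := ht0
  have : t + ε / 2 ∈ T := ⟨by simp only [Set.mem_Ici]; linarith, hUP (hball hmem)⟩
  have h : t + ε / 2 ≤ t := htmax this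
  linarith

/-- The boundary of a convex body is not longer than that of a bounded closed set around it. -/
theorem Convex.hausdorffMeasure_frontier_le [CompleteSpace E] [MeasurableSpace E] [BorelSpace E]
    {K P U : Set E} (hK : Convex ℝ K) (hKc : IsClosed K) (hne : (interior K).Nonempty)
    (hKP : K ⊆ P) (hP : IsClosed P) (hb : Bornology.IsBounded P) (hU : IsOpen U) (hUP : U ⊆ P) :
    μH[1] (frontier K) ≤ μH[1] (P \ U) := by
  obtain ⟨g, hg⟩ := hK.exists_nearest_point_map hKc.isComplete (hne.mono interior_subset)
  have hsub : frontier K ⊆ g '' (P \ U) := by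
    intro x hx
    have hxK : x ∈ K := hKc.frontier_subset hx
    obtain ⟨ν, hν, hν'⟩ := hK.exists_outer_normal hne hx
    have hν0 : ν ≠ 0 := by
      rintro rfl
      obtain ⟨o, ho⟩ := hne
      simpa using hν' o ho
    -- Every point of the outward normal ray at x has x as its nearest point in K.
    obtain ⟨t, ht, hmem⟩ := exists_ray_mem_diff hP hb hU hUP (hKP hxK) hν0
    refine ⟨_, hmem, eq_of_obtuse ((hg _).2 x hxK) ?_⟩
    rw [add_sub_cancel_left, inner_smul_left, inner_sub_right]
    have := hν _ (hg (x + t • ν)).1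
    exact mul_nonpos_of_nonneg_of_nonpos (by simpa using ht) (by linarith)
  calc μH[1] (frontier K) ≤ μH[1] (g '' (P \ U)) := MeasureTheory.measure_mono hsub
    _ ≤ _ := by
      simpa using (lipschitzWith_one_of_obtuse hg).hausdorffMeasure_image_le zero_le_one (P \ U)

/-- The length of a part of a line with parameters in `[lo, hi]`. -/
theorem hausdorffMeasure_le_of_line [MeasurableSpace E] [BorelSpace E] {S : Set E} {p w : E}
    {lo hi : ℝ} (hS : ∀ z ∈ S, ∃ t ∈ Set.Icc lo hi, z = p + t • w) :
    μH[1] S ≤ ENNReal.ofReal ((hi - lo) * ‖w‖) := by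
  have hlip : LipschitzWith ‖w‖₊ fun t : ℝ => p + t • w := by
    refine LipschitzWith.of_dist_le_mul fun s t => le_of_eq ?_
    rw [dist_add_left, dist_eq_norm, ← sub_smul, norm_smul, Real.dist_eq, Real.norm_eq_abs,
      coe_nnnorm, mul_comm]
  calc μH[1] S ≤ μH[1] ((fun t : ℝ => p + t • w) '' Set.Icc lo hi) := by
        refine MeasureTheory.measure_mono fun z hz => ?_
        obtain ⟨t, ht, rfl⟩ := hS z hz
        exact ⟨t, ht, rfl⟩
    _ ≤ _ := hlip.hausdorffMeasure_image_le zero_le_one _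
    _ = _ := by
      rw [MeasureTheory.hausdorffMeasure_real, Real.volume_Icc, ENNReal.ofReal_mul' (norm_nonneg w),
        mul_comm]
      simp [← enorm_eq_nnnorm]

end Projection

/-! ### Paths through four points -/

section Polyline

/-- A curve through four points is at least as long as the shortest polygonal line
with these vertices. -/
theorem le_eVariationOn_of_four_points {α X : Type*} [LinearOrder α] [PseudoEMetricSpace X]
    {f : α → X} {s : Set α} {L : ℝ≥0∞} (t : Fin 4 → α) (ht : ∀ i, t i ∈ s)
    (hL : ∀ i j k l : Fin 4, i ≠ j → i ≠ k → i ≠ l → j ≠ k → j ≠ l → k ≠ l →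
      L ≤ edist (f (t i)) (f (t j)) + edist (f (t j)) (f (t k)) + edist (f (t k)) (f (t l))) :
    L ≤ eVariationOn f s := by
  set σ := Tuple.sort t
  have hσ : Monotone (t ∘ σ) := Tuple.monotone_sort t
  -- The visiting times in increasing order; past index 3 the sequence is constant, hence monotone
  -- on all of ℕ.
  let u : ℕ → α := fun n => t (σ ⟨min n 3, by omega⟩)
  have hu : Monotone u := fun m n hmn => hσ (Fin.mk_le_mk.2 (min_le_min_right 3 hmn))
  have h := eVariationOn.sum_le (f := f) (s := s) (n := 3) hu fun i => ht _
  refine le_trans ?_ h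
  have hne : ∀ i j : Fin 4, i ≠ j → σ i ≠ σ j := fun i j hij => σ.injective.ne hij
  refine (hL (σ 0) (σ 1) (σ 2) (σ 3) (hne _ _ (by decide)) (hne _ _ (by decide))
    (hne _ _ (by decide)) (hne _ _ (by decide)) (hne _ _ (by decide))
    (hne _ _ (by decide))).trans (le_of_eq ?_)
  simp only [Finset.sum_range_succ, Finset.sum_range_zero, zero_add, edist_comm]
  rfl

/-- The twelve polygonal lines through four points `a, b, c, d` such that `c` and `d` are
equidistant from `a` and `b`. -/
theorem le_eVariationOn_of_kite {α X : Type*} [LinearOrder α] [PseudoMetricSpace X]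
    {f : α → X} {s : Set α} {L D p q r : ℝ} {ta tb tc td : α}
    (ha : ta ∈ s) (hb : tb ∈ s) (hc : tc ∈ s) (hd : td ∈ s)
    (hab : dist (f ta) (f tb) = D) (hac : dist (f ta) (f tc) = p) (hbc : dist (f tb) (f tc) = p)
    (had : dist (f ta) (f td) = q) (hbd : dist (f tb) (f td) = q) (hcd : dist (f tc) (f td) = r)
    (hpD : p ≤ D) (hqD : q ≤ D) (hrD : r ≤ D)
    (h1 : L ≤ p + q + r) (h2 : L ≤ 2 * p + q) (h3 : L ≤ p + 2 * q) :
    ENNReal.ofReal L ≤ eVariationOn f s := by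
  refine le_eVariationOn_of_four_points ![ta, tb, tc, td]
    (by intro i; fin_cases i <;> assumption) ?_
  intro i j k l hij hik hil hjk hjl hkl
  simp only [edist_dist]
  rw [← ENNReal.ofReal_add dist_nonneg dist_nonneg,
    ← ENNReal.ofReal_add (add_nonneg dist_nonneg dist_nonneg) dist_nonneg]
  apply ENNReal.ofReal_le_ofReal
  have hab' := hab
  have hac' := hac
  have hbc' := hbc
  have had' := had
  have hbd' := hbd
  have hcd' := hcd
  rw [dist_comm] at hab' hac' hbc' had' hbd' hcd'
  fin_cases i <;> fin_cases j <;> first | exact absurd rfl hij | skip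
  all_goals fin_cases k <;> first | exact absurd rfl hik | exact absurd rfl hjk | skip
  all_goals
    fin_cases l <;>
      first | exact absurd rfl hil | exact absurd rfl hjl | exact absurd rfl hkl | skip
  all_goals
    simp [hab, hac, hbc, had, hbd, hcd, hab', hac', hbc', had', hbd', hcd']
    linarith

end Polyline

/-! ### Coordinates and lengths of segments -/

section Coordinates

theorem continuous_coord (i : Fin 2) : Continuous fun z : EuclPlane => z i :=
  (EuclideanSpace.proj (𝕜 := ℝ) i).continuous

theorem dist_eq_sqrt_coords (z w : EuclPlane) :
    dist z w = √((z 0 - w 0) ^ 2 + (z 1 - w 1) ^ 2) := by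
  rw [EuclideanSpace.dist_eq, Fin.sum_univ_two, Real.dist_eq, Real.dist_eq, sq_abs, sq_abs]

theorem sq_dist_coords (z w : EuclPlane) :
    dist z w ^ 2 = (z 0 - w 0) ^ 2 + (z 1 - w 1) ^ 2 := by
  rw [dist_eq_sqrt_coords, Real.sq_sqrt (by positivity)]

theorem isBounded_of_coords {P : Set EuclPlane} {x₁ x₂ y₁ y₂ : ℝ}
    (h : ∀ z ∈ P, x₁ ≤ z 0 ∧ z 0 ≤ x₂ ∧ y₁ ≤ z 1 ∧ z 1 ≤ y₂) : Bornology.IsBounded P := by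
  refine Metric.isBounded_iff.2 ⟨(x₂ - x₁) + (y₂ - y₁), fun z hz w hw => ?_⟩
  obtain ⟨h1, h2, h3, h4⟩ := h z hz
  obtain ⟨h5, h6, h7, h8⟩ := h w hw
  rw [dist_eq_sqrt_coords]
  refine Real.sqrt_le_iff.2 ⟨by linarith, ?_⟩
  have e1 : (z 0 - w 0) ^ 2 ≤ (x₂ - x₁) ^ 2 := sq_le_sq' (by linarith) (by linarith)
  have e2 : (z 1 - w 1) ^ 2 ≤ (y₂ - y₁) ^ 2 := sq_le_sq' (by linarith) (by linarith)
  have e3 : 0 ≤ (x₂ - x₁) * (y₂ - y₁) := mul_nonneg (by linarith) (by linarith)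
  nlinarith

/-- The set `S` has length at most `x`. -/
def LengthLE (S : Set EuclPlane) (x : ℝ) : Prop := 0 ≤ x ∧ μH[1] S ≤ ENNReal.ofReal x

theorem LengthLE.union {S T : Set EuclPlane} {x y : ℝ} (hS : LengthLE S x) (hT : LengthLE T y) :
    LengthLE (S ∪ T) (x + y) :=
  ⟨add_nonneg hS.1 hT.1, (MeasureTheory.measure_union_le S T).trans <| by
    rw [ENNReal.ofReal_add hS.1 hT.1]; exact add_le_add hS.2 hT.2⟩

theorem lengthLE_of_line {S : Set EuclPlane} (p₀ p₁ w₀ w₁ : ℝ) {lo hi ℓ : ℝ} (hℓ : 0 ≤ ℓ)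
    (hw : w₀ ^ 2 + w₁ ^ 2 = ℓ ^ 2) (hlohi : lo ≤ hi)
    (hS : ∀ z ∈ S, ∃ t, lo ≤ t ∧ t ≤ hi ∧ z 0 = p₀ + t * w₀ ∧ z 1 = p₁ + t * w₁) :
    LengthLE S ((hi - lo) * ℓ) := by
  refine ⟨mul_nonneg (sub_nonneg.2 hlohi) hℓ, ?_⟩
  have hnorm : ‖(!₂[w₀, w₁] : EuclPlane)‖ = ℓ := by
    rw [EuclideanSpace.norm_eq, Fin.sum_univ_two]
    simp [hw, Real.sqrt_sq hℓ]
  rw [← hnorm]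
  refine hausdorffMeasure_le_of_line (p := !₂[p₀, p₁]) fun z hz => ?_
  obtain ⟨t, h1, h2, h3, h4⟩ := hS z hz
  refine ⟨t, ⟨h1, h2⟩, ?_⟩
  ext i
  fin_cases i
  · simpa using h3
  · simpa using h4

end Coordinates

/-! ### Perimeter bounds from circumscribed polygons -/

section Perimeter

variable {K : Set EuclPlane}

/-- With P given by weak and U by strict inequalities, `P \ U` is covered by the sides of the
polygon, so no frontier has to be computed. -/
theorem IsConvexShape.perimeter_le {P U S : Set EuclPlane} {x : ℝ} (hK : IsConvexShape K)
    (hKP : K ⊆ P) (hP : IsClosed P) (hb : Bornology.IsBounded P) (hU : IsOpen U) (hUP : U ⊆ P)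
    (hPS : P \ U ⊆ S) (hS : LengthLE S x) : perimeter K ≤ ENNReal.ofReal x :=
  (hK.convex.hausdorffMeasure_frontier_le hK.isCompact.isClosed hK.nonempty_interior hKP hP hb hU
    hUP).trans ((MeasureTheory.measure_mono hPS).trans hS.2)

/-- The perimeter of a convex shape in a vertical strip of width `2 * r`, bounded by two lines
that meet the axis of the strip at heights `h` and `-k`. -/
theorem IsConvexShape.perimeter_le_trapezoid (hK : IsConvexShape K) {r h k m n : ℝ} (hr : 0 ≤ r)
    (hm : m * r ≤ h) (hm' : -(m * r) ≤ h) (hn : n * r ≤ k) (hn' : -(n * r) ≤ k)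
    (hKP : ∀ z ∈ K, -r ≤ z 0 ∧ z 0 ≤ r ∧ -k + n * z 0 ≤ z 1 ∧ z 1 ≤ h + m * z 0) :
    perimeter K ≤ ENNReal.ofReal (2 * (√(r ^ 2 + h ^ 2) + √(r ^ 2 + k ^ 2) + (h + k))) := by
  have c0 := continuous_coord 0
  have c1 := continuous_coord 1
  let P : Set EuclPlane := {z | -r ≤ z 0} ∩ {z | z 0 ≤ r} ∩ {z | -k + n * z 0 ≤ z 1} ∩
    {z | z 1 ≤ h + m * z 0}
  let U : Set EuclPlane := {z | -r < z 0} ∩ {z | z 0 < r} ∩ {z | -k + n * z 0 < z 1} ∩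
    {z | z 1 < h + m * z 0}
  have hP : IsClosed P :=
    (((isClosed_le continuous_const c0).inter (isClosed_le c0 continuous_const)).inter
      (isClosed_le (by fun_prop) c1)).inter (isClosed_le c1 (by fun_prop))
  have hU : IsOpen U :=
    (((isOpen_lt continuous_const c0).inter (isOpen_lt c0 continuous_const)).inter
      (isOpen_lt (by fun_prop) c1)).inter (isOpen_lt c1 (by fun_prop))
  have hUP : U ⊆ P := by
    rintro z ⟨⟨⟨h1, h2⟩, h3⟩, h4⟩
    simp only [Set.mem_ofPred_eq] at h1 h2 h3 h4
    exact ⟨⟨⟨h1.le, h2.le⟩, h3.le⟩, h4.le⟩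
  have slope : ∀ {m' h' : ℝ} (x : ℝ), m' * r ≤ h' → -(m' * r) ≤ h' → -r ≤ x → x ≤ r →
      m' * x ≤ h' ∧ -h' ≤ m' * x := by
    intro m' h' x h1 h2 h3 h4
    rcases le_total 0 m' with h5 | h5 <;> constructor <;> nlinarith
  have hb : Bornology.IsBounded P := by
    refine isBounded_of_coords (x₁ := -r) (x₂ := r) (y₁ := -k - k) (y₂ := h + h) ?_
    rintro z ⟨⟨⟨h1, h2⟩, h3⟩, h4⟩
    have e1 := (slope (z 0) hm hm' h1 h2).1
    have e2 := (slope (z 0) hn hn' h1 h2).2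
    simp only [Set.mem_ofPred_eq] at h1 h2 h3 h4
    exact ⟨h1, h2, by linarith, by linarith⟩
  have side : ∀ {m' h' : ℝ}, m' * r ≤ h' → -(m' * r) ≤ h' →
      (r - -r) * √(1 + m' ^ 2) ≤ 2 * √(r ^ 2 + h' ^ 2) := by
    intro m' h' h1 h2
    have e : (m' * r) ^ 2 ≤ h' ^ 2 := sq_le_sq' (by linarith) h1
    have e2 : r * √(1 + m' ^ 2) ≤ √(r ^ 2 + h' ^ 2) := by
      refine Real.le_sqrt_of_sq_le ?_
      rw [mul_pow, Real.sq_sqrt (by positivity)]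
      linarith
    linarith
  -- The slopes enter the two vertical sides with opposite signs, so these sides add up to 2(h + k).
  have L1 : LengthLE {z | z ∈ P ∧ z 0 = r} ((h + m * r - (-k + n * r)) * 1) := by
    refine lengthLE_of_line r 0 0 1 (by norm_num) (by norm_num) (by linarith) ?_
    rintro z ⟨⟨⟨⟨h1, h2⟩, h3⟩, h4⟩, h5⟩
    simp only [Set.mem_ofPred_eq] at h3 h4
    rw [h5] at h3 h4
    exact ⟨z 1, h3, h4, by linarith, by ring⟩
  have L2 : LengthLE {z | z ∈ P ∧ z 0 = -r} ((h + m * (-r) - (-k + n * (-r))) * 1) := by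
    refine lengthLE_of_line (-r) 0 0 1 (by norm_num) (by norm_num) (by linarith) ?_
    rintro z ⟨⟨⟨⟨h1, h2⟩, h3⟩, h4⟩, h5⟩
    simp only [Set.mem_ofPred_eq] at h3 h4
    rw [h5] at h3 h4
    exact ⟨z 1, h3, h4, by linarith, by ring⟩
  have L3 : LengthLE {z | z ∈ P ∧ z 1 = h + m * z 0} ((r - -r) * √(1 + m ^ 2)) := by
    refine lengthLE_of_line 0 h 1 m (Real.sqrt_nonneg _)
      (by rw [Real.sq_sqrt (by positivity)]; ring) (by linarith) ?_
    rintro z ⟨⟨⟨⟨h1, h2⟩, h3⟩, h4⟩, h5⟩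
    exact ⟨z 0, h1, h2, by ring, by rw [h5]; ring⟩
  have L4 : LengthLE {z | z ∈ P ∧ z 1 = -k + n * z 0} ((r - -r) * √(1 + n ^ 2)) := by
    refine lengthLE_of_line 0 (-k) 1 n (Real.sqrt_nonneg _)
      (by rw [Real.sq_sqrt (by positivity)]; ring) (by linarith) ?_
    rintro z ⟨⟨⟨⟨h1, h2⟩, h3⟩, h4⟩, h5⟩
    exact ⟨z 0, h1, h2, by ring, by rw [h5]; ring⟩
  refine (hK.perimeter_le (P := P) (U := U) ?_ hP hb hU hUP ?_
    (((L1.union L2).union L3).union L4)).trans (ENNReal.ofReal_le_ofReal ?_)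
  · intro z hz
    obtain ⟨h1, h2, h3, h4⟩ := hKP z hz
    exact ⟨⟨⟨h1, h2⟩, h3⟩, h4⟩
  · rintro z ⟨hz, hzU⟩
    have hz' := hz
    obtain ⟨⟨⟨h1, h2⟩, h3⟩, h4⟩ := hz'
    simp only [Set.mem_ofPred_eq] at h1 h2 h3 h4
    rcases eq_or_lt_of_le h2 with e2 | e2
    · exact Or.inl (Or.inl (Or.inl ⟨hz, e2⟩))
    rcases eq_or_lt_of_le h1 with e1 | e1
    · exact Or.inl (Or.inl (Or.inr ⟨hz, e1.symm⟩))
    rcases eq_or_lt_of_le h4 with e4 | e4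
    · exact Or.inl (Or.inr ⟨hz, e4⟩)
    rcases eq_or_lt_of_le h3 with e3 | e3
    · exact Or.inr ⟨hz, e3.symm⟩
    · exact absurd ⟨⟨⟨e1, e2⟩, e3⟩, e4⟩ hzU
  · have := side hm hm'
    have := side hn hn'
    linarith

/-- The range of a functional on a compact set of given diameter. -/
theorem exists_extremal_points (hK : IsCompact K) (hne : K.Nonempty) {f : EuclPlane → ℝ} {C : ℝ}
    (hf : Continuous f) (hC : 0 ≤ C) (hfC : ∀ z w, f z - f w ≤ C * dist z w) :
    ∃ z₁ ∈ K, ∃ z₂ ∈ K, (∀ z ∈ K, f z₁ ≤ f z) ∧ (∀ z ∈ K, f z ≤ f z₂) ∧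
      f z₂ - f z₁ ≤ C * Metric.diam K := by
  obtain ⟨z₁, h1, h1'⟩ := hK.exists_isMinOn hne hf.continuousOn
  obtain ⟨z₂, h2, h2'⟩ := hK.exists_isMaxOn hne hf.continuousOn
  exact ⟨z₁, h1, z₂, h2, fun z hz => h1' hz, fun z hz => h2' hz, (hfC z₂ z₁).trans
    (mul_le_mul_of_nonneg_left (Metric.dist_le_diam_of_mem hK.isBounded h2 h1) hC)⟩

/-- A convex shape is not longer than a circumscribed equiangular octagon, whose
perimeter is at most `8 * (√2 - 1)` times the diameter. -/
theorem IsConvexShape.perimeter_le_diam (hK : IsConvexShape K) :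
    perimeter K ≤ ENNReal.ofReal (8 * (√2 - 1) * Metric.diam K) := by
  have c0 := continuous_coord 0
  have c1 := continuous_coord 1
  have hne : K.Nonempty := hK.nonempty_interior.mono interior_subset
  have s2 : (√2 : ℝ) ^ 2 = 2 := Real.sq_sqrt (by norm_num)
  have s2' : 1 ≤ √2 := Real.one_le_sqrt.2 (by norm_num)
  have s2'' : √2 ≤ 2 := Real.sqrt_le_iff.2 ⟨by norm_num, by norm_num⟩
  obtain ⟨a₁, ha₁, a₂, ha₂, hx₁, hx₂, hx⟩ := exists_extremal_points hK.isCompact hne c0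
    zero_le_one fun z w => by
      refine le_of_sq_le_sq ?_ (by positivity)
      rw [mul_pow, sq_dist_coords]; nlinarith [sq_nonneg (z 1 - w 1)]
  obtain ⟨b₁, hb₁, b₂, hb₂, hy₁, hy₂, hy⟩ := exists_extremal_points hK.isCompact hne c1
    zero_le_one fun z w => by
      refine le_of_sq_le_sq ?_ (by positivity)
      rw [mul_pow, sq_dist_coords]; nlinarith [sq_nonneg (z 0 - w 0)]
  obtain ⟨p₁, hp₁, p₂, hp₂, hs₁, hs₂, hs⟩ := exists_extremal_points hK.isCompact hne
    (f := fun z => z 0 + z 1) (c0.add c1) (Real.sqrt_nonneg 2) fun z w => by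
      refine le_of_sq_le_sq ?_ (by positivity)
      rw [mul_pow, sq_dist_coords, s2]; nlinarith [sq_nonneg ((z 0 - w 0) - (z 1 - w 1))]
  obtain ⟨q₁, hq₁, q₂, hq₂, hd₁, hd₂, hd⟩ := exists_extremal_points hK.isCompact hne
    (f := fun z => z 0 - z 1) (c0.sub c1) (Real.sqrt_nonneg 2) fun z w => by
      refine le_of_sq_le_sq ?_ (by positivity)
      rw [mul_pow, sq_dist_coords, s2]; nlinarith [sq_nonneg ((z 0 - w 0) + (z 1 - w 1))]
  have tight : ∀ z ∈ K, a₁ 0 ≤ z 0 ∧ z 0 ≤ a₂ 0 ∧ b₁ 1 ≤ z 1 ∧ z 1 ≤ b₂ 1 ∧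
      p₁ 0 + p₁ 1 ≤ z 0 + z 1 ∧ z 0 + z 1 ≤ p₂ 0 + p₂ 1 ∧
      q₁ 0 - q₁ 1 ≤ z 0 - z 1 ∧ z 0 - z 1 ≤ q₂ 0 - q₂ 1 := fun z hz =>
    ⟨hx₁ z hz, hx₂ z hz, hy₁ z hz, hy₂ z hz, hs₁ z hz, hs₂ z hz, hd₁ z hz, hd₂ z hz⟩
  -- The contact points witness that each constraint is attained, which makes all eight side lengths
  -- below nonnegative.
  have ta₁ := tight _ ha₁
  have ta₂ := tight _ ha₂
  have tb₁ := tight _ hb₁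
  have tb₂ := tight _ hb₂
  have tp₁ := tight _ hp₁
  have tp₂ := tight _ hp₂
  have tq₁ := tight _ hq₁
  have tq₂ := tight _ hq₂
  clear hx₁ hx₂ hy₁ hy₂ hs₁ hs₂ hd₁ hd₂
  simp only at hx hy hs hd
  generalize hX₁ : a₁ 0 = x₁ at *
  generalize hX₂ : a₂ 0 = x₂ at *
  generalize hY₁ : b₁ 1 = y₁ at *
  generalize hY₂ : b₂ 1 = y₂ at *
  generalize hS₁ : p₁ 0 + p₁ 1 = u₁ at *
  generalize hS₂ : p₂ 0 + p₂ 1 = u₂ at *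
  generalize hD₁ : q₁ 0 - q₁ 1 = v₁ at *
  generalize hD₂ : q₂ 0 - q₂ 1 = v₂ at *
  let P : Set EuclPlane := ({z | x₁ ≤ z 0} ∩ {z | z 0 ≤ x₂}) ∩ ({z | y₁ ≤ z 1} ∩ {z | z 1 ≤ y₂}) ∩
    ({z | u₁ ≤ z 0 + z 1} ∩ {z | z 0 + z 1 ≤ u₂}) ∩ ({z | v₁ ≤ z 0 - z 1} ∩ {z | z 0 - z 1 ≤ v₂})
  let U : Set EuclPlane := ({z | x₁ < z 0} ∩ {z | z 0 < x₂}) ∩ ({z | y₁ < z 1} ∩ {z | z 1 < y₂}) ∩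
    ({z | u₁ < z 0 + z 1} ∩ {z | z 0 + z 1 < u₂}) ∩ ({z | v₁ < z 0 - z 1} ∩ {z | z 0 - z 1 < v₂})
  have closed_strip : ∀ {f : EuclPlane → ℝ} (l u : ℝ), Continuous f →
      IsClosed ({z | l ≤ f z} ∩ {z | f z ≤ u}) := fun l u hf =>
    (isClosed_le continuous_const hf).inter (isClosed_le hf continuous_const)
  have open_strip : ∀ {f : EuclPlane → ℝ} (l u : ℝ), Continuous f →
      IsOpen ({z | l < f z} ∩ {z | f z < u}) := fun l u hf =>
    (isOpen_lt continuous_const hf).inter (isOpen_lt hf continuous_const)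
  have hP : IsClosed P := (((closed_strip x₁ x₂ c0).inter (closed_strip y₁ y₂ c1)).inter
    (closed_strip u₁ u₂ (c0.add c1))).inter (closed_strip v₁ v₂ (c0.sub c1))
  have hU : IsOpen U := (((open_strip x₁ x₂ c0).inter (open_strip y₁ y₂ c1)).inter
    (open_strip u₁ u₂ (c0.add c1))).inter (open_strip v₁ v₂ (c0.sub c1))
  have memP : ∀ z, z ∈ P ↔ x₁ ≤ z 0 ∧ z 0 ≤ x₂ ∧ y₁ ≤ z 1 ∧ z 1 ≤ y₂ ∧
      u₁ ≤ z 0 + z 1 ∧ z 0 + z 1 ≤ u₂ ∧ v₁ ≤ z 0 - z 1 ∧ z 0 - z 1 ≤ v₂ := fun z => by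
    simp only [P, Set.mem_inter_iff, Set.mem_ofPred_eq, and_assoc]
  have memU : ∀ z, z ∈ U ↔ x₁ < z 0 ∧ z 0 < x₂ ∧ y₁ < z 1 ∧ z 1 < y₂ ∧
      u₁ < z 0 + z 1 ∧ z 0 + z 1 < u₂ ∧ v₁ < z 0 - z 1 ∧ z 0 - z 1 < v₂ := fun z => by
    simp only [U, Set.mem_inter_iff, Set.mem_ofPred_eq, and_assoc]
  have hUP : U ⊆ P := fun z hz => by
    obtain ⟨h1, h2, h3, h4, h5, h6, h7, h8⟩ := (memU z).1 hz
    exact (memP z).2 ⟨h1.le, h2.le, h3.le, h4.le, h5.le, h6.le, h7.le, h8.le⟩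
  have hb : Bornology.IsBounded P := isBounded_of_coords fun z hz => by
    obtain ⟨h1, h2, h3, h4, -⟩ := (memP z).1 hz
    exact ⟨h1, h2, h3, h4⟩
  have L1 : LengthLE {z | z ∈ P ∧ z 0 = x₁} ((x₁ - v₁ - (u₁ - x₁)) * 1) := by
    refine lengthLE_of_line x₁ 0 0 1 (by norm_num) (by norm_num) (by linarith) ?_
    rintro z ⟨hz, e⟩
    obtain ⟨h1, h2, h3, h4, h5, h6, h7, h8⟩ := (memP z).1 hz
    exact ⟨z 1, by linarith, by linarith, by linarith, by ring⟩
  have L2 : LengthLE {z | z ∈ P ∧ z 0 = x₂} ((u₂ - x₂ - (x₂ - v₂)) * 1) := by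
    refine lengthLE_of_line x₂ 0 0 1 (by norm_num) (by norm_num) (by linarith) ?_
    rintro z ⟨hz, e⟩
    obtain ⟨h1, h2, h3, h4, h5, h6, h7, h8⟩ := (memP z).1 hz
    exact ⟨z 1, by linarith, by linarith, by linarith, by ring⟩
  have L3 : LengthLE {z | z ∈ P ∧ z 1 = y₁} ((v₂ + y₁ - (u₁ - y₁)) * 1) := by
    refine lengthLE_of_line 0 y₁ 1 0 (by norm_num) (by norm_num) (by linarith) ?_
    rintro z ⟨hz, e⟩
    obtain ⟨h1, h2, h3, h4, h5, h6, h7, h8⟩ := (memP z).1 hz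
    exact ⟨z 0, by linarith, by linarith, by ring, by linarith⟩
  have L4 : LengthLE {z | z ∈ P ∧ z 1 = y₂} ((u₂ - y₂ - (v₁ + y₂)) * 1) := by
    refine lengthLE_of_line 0 y₂ 1 0 (by norm_num) (by norm_num) (by linarith) ?_
    rintro z ⟨hz, e⟩
    obtain ⟨h1, h2, h3, h4, h5, h6, h7, h8⟩ := (memP z).1 hz
    exact ⟨z 0, by linarith, by linarith, by ring, by linarith⟩
  have L5 : LengthLE {z | z ∈ P ∧ z 0 + z 1 = u₁} ((u₁ - y₁ - x₁) * √2) := by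
    refine lengthLE_of_line 0 u₁ 1 (-1) (by positivity) (by rw [s2]; norm_num) (by linarith) ?_
    rintro z ⟨hz, e⟩
    obtain ⟨h1, h2, h3, h4, h5, h6, h7, h8⟩ := (memP z).1 hz
    exact ⟨z 0, by linarith, by linarith, by ring, by linarith⟩
  have L6 : LengthLE {z | z ∈ P ∧ z 0 + z 1 = u₂} ((x₂ - (u₂ - y₂)) * √2) := by
    refine lengthLE_of_line 0 u₂ 1 (-1) (by positivity) (by rw [s2]; norm_num) (by linarith) ?_
    rintro z ⟨hz, e⟩
    obtain ⟨h1, h2, h3, h4, h5, h6, h7, h8⟩ := (memP z).1 hz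
    exact ⟨z 0, by linarith, by linarith, by ring, by linarith⟩
  have L7 : LengthLE {z | z ∈ P ∧ z 0 - z 1 = v₁} ((v₁ + y₂ - x₁) * √2) := by
    refine lengthLE_of_line 0 (-v₁) 1 1 (by positivity) (by rw [s2]; norm_num) (by linarith) ?_
    rintro z ⟨hz, e⟩
    obtain ⟨h1, h2, h3, h4, h5, h6, h7, h8⟩ := (memP z).1 hz
    exact ⟨z 0, by linarith, by linarith, by ring, by linarith⟩
  have L8 : LengthLE {z | z ∈ P ∧ z 0 - z 1 = v₂} ((x₂ - (v₂ + y₁)) * √2) := by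
    refine lengthLE_of_line 0 (-v₂) 1 1 (by positivity) (by rw [s2]; norm_num) (by linarith) ?_
    rintro z ⟨hz, e⟩
    obtain ⟨h1, h2, h3, h4, h5, h6, h7, h8⟩ := (memP z).1 hz
    exact ⟨z 0, by linarith, by linarith, by ring, by linarith⟩
  refine (hK.perimeter_le (P := P) (U := U) (fun z hz => (memP z).2 (tight z hz)) hP hb hU hUP ?_
    (((L1.union L2).union (L3.union L4)).union ((L5.union L6).union (L7.union L8)))).trans
    (ENNReal.ofReal_le_ofReal ?_)
  · rintro z ⟨hz, hzU⟩
    obtain ⟨h1, h2, h3, h4, h5, h6, h7, h8⟩ := (memP z).1 hz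
    rcases h1.eq_or_lt with e1 | e1
    · exact Or.inl (Or.inl (Or.inl ⟨hz, e1.symm⟩))
    rcases h2.eq_or_lt with e2 | e2
    · exact Or.inl (Or.inl (Or.inr ⟨hz, e2⟩))
    rcases h3.eq_or_lt with e3 | e3
    · exact Or.inl (Or.inr (Or.inl ⟨hz, e3.symm⟩))
    rcases h4.eq_or_lt with e4 | e4
    · exact Or.inl (Or.inr (Or.inr ⟨hz, e4⟩))
    rcases h5.eq_or_lt with e5 | e5
    · exact Or.inr (Or.inl (Or.inl ⟨hz, e5.symm⟩))
    rcases h6.eq_or_lt with e6 | e6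
    · exact Or.inr (Or.inl (Or.inr ⟨hz, e6⟩))
    rcases h7.eq_or_lt with e7 | e7
    · exact Or.inr (Or.inr (Or.inl ⟨hz, e7.symm⟩))
    rcases h8.eq_or_lt with e8 | e8
    · exact Or.inr (Or.inr (Or.inr ⟨hz, e8⟩))
    · exact absurd ((memU z).2 ⟨e1, e2, e3, e4, e5, e6, e7, e8⟩) hzU
  -- The sides sum to (2√2 - 2) times the axis widths plus (2 - √2) times the ranges of x + y and x
  -- - y. Both coefficients are nonnegative, so the width bounds apply.
  · have e1 := mul_le_mul_of_nonneg_left (add_le_add hs hd) (sub_nonneg.2 s2'')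
    have e2 := mul_le_mul_of_nonneg_left (add_le_add hx hy)
      (by linarith : 0 ≤ 2 * √2 - 2)
    have e3 : (2 - √2) * (√2 * Metric.diam K + √2 * Metric.diam K)
        = 4 * (√2 - 1) * Metric.diam K := by
      linear_combination (-2 * Metric.diam K) * s2
    rw [e3] at e1
    linarith

end Perimeter

/-! ### The kite in normal position -/

section NormalPosition

theorem inner_coords (z w : EuclPlane) : inner ℝ z w = z 0 * w 0 + z 1 * w 1 := by
  rw [PiLp.inner_apply, Fin.sum_univ_two]
  simp [mul_comm]

theorem ext_coords {z w : EuclPlane} (h0 : z 0 = w 0) (h1 : z 1 = w 1) : z = w := by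
  ext i
  fin_cases i
  · exact h0
  · exact h1

theorem mem_frontier_of_direction {K : Set EuclPlane} {z v : EuclPlane} (hz : z ∈ K)
    (hv : ∀ ε : ℝ, 0 < ε → z + ε • v ∉ K) : z ∈ frontier K := by
  refine ⟨subset_closure hz, fun hzi => ?_⟩
  have hcont : Continuous fun ε : ℝ => z + ε • v := by fun_prop
  have h : (fun ε : ℝ => z + ε • v) ⁻¹' K ∈ nhds 0 :=
    hcont.continuousAt.preimage_mem_nhds (by simpa using mem_interior_iff_mem_nhds.1 hzi)
  obtain ⟨ε, hε, hball⟩ := Metric.mem_nhds_iff.1 h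
  refine hv (ε / 2) (half_pos hε) (hball ?_)
  rw [Metric.mem_ball, Real.dist_eq, sub_zero, abs_of_pos (half_pos hε)]
  linarith

/-- A convex set with points of its interior on one side of a line and a point on the other side
has an interior point on the line. -/
theorem Convex.exists_interior_coord_eq_zero {K : Set EuclPlane} (hK : Convex ℝ K)
    {w a : EuclPlane} (hw : w ∈ interior K) (ha : a ∈ K) (h : w 0 * a 0 < 0) :
    ∃ o ∈ interior K, o 0 = 0 := by
  have hsum : w 0 ≠ a 0 := fun e => by rw [e] at h; nlinarith [mul_self_nonneg (a 0)]
  have hne : w 0 - a 0 ≠ 0 := sub_ne_zero.2 hsum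
  have hpos : 0 < -a 0 / (w 0 - a 0) ∧ 0 < w 0 / (w 0 - a 0) := by
    rcases mul_neg_iff.1 h with ⟨h1, h2⟩ | ⟨h1, h2⟩
    · exact ⟨div_pos (by linarith) (by linarith), div_pos h1 (by linarith)⟩
    · exact ⟨div_pos_of_neg_of_neg (by linarith) (by linarith),
        div_pos_of_neg_of_neg h1 (by linarith)⟩
  refine ⟨_, hK.openSegment_interior_self_subset_interior hw ha
    ⟨-a 0 / (w 0 - a 0), w 0 / (w 0 - a 0), hpos.1, hpos.2, ?_, rfl⟩, ?_⟩
  · field_simp; ring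
  · simp only [PiLp.add_apply, PiLp.smul_apply, smul_eq_mul]
    field_simp; ring

/-- The kite is longer than half of the octagon if its short sides are not longer
than the diagonal on its axis. -/
theorem octagon_le_kite {r h k : ℝ} (hr : 0 ≤ r) (hs : √(r ^ 2 + k ^ 2) ≤ h + k) :
    8 * (√2 - 1) * r ≤ √(r ^ 2 + h ^ 2) + 2 * √(r ^ 2 + k ^ 2) := by
  -- Linear lower bounds for the two norms. Substituting h ≥ √(r² + k²) - k leaves 13/5 of the
  -- second norm minus 3k/5; the coefficient 60/260 cancels k exactly, and 4/5 + (13/5)(252/260) =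
  -- 3.32 = 8(1.415 - 1).
  have h1 : 4 / 5 * r + 3 / 5 * h ≤ √(r ^ 2 + h ^ 2) :=
    Real.le_sqrt_of_sq_le (by nlinarith [sq_nonneg (3 * r - 4 * h)])
  have h2 : 252 / 260 * r + 60 / 260 * k ≤ √(r ^ 2 + k ^ 2) :=
    Real.le_sqrt_of_sq_le (by nlinarith [sq_nonneg (r - 4 * k)])
  have h3 : √2 ≤ 1.415 := Real.sqrt_le_iff.2 ⟨by norm_num, by norm_num⟩
  have h4 : √2 * r ≤ 1.415 * r := mul_le_mul_of_nonneg_right h3 hr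
  linarith

theorem IsConvexShape.exists_kite_of_normal_position {K : Set EuclPlane} (hK : IsConvexShape K)
    {r : ℝ} (hr : 0 < r) {a b : EuclPlane} (ha : a ∈ K) (hb : b ∈ K) (hdiam : Metric.diam K = 2 * r)
    (ha0 : a 0 = -r) (ha1 : a 1 = 0) (hb0 : b 0 = r) (hb1 : b 1 = 0) :
    ∃ c d : EuclPlane,
      (AffineSubspace.perpBisector a b : Set EuclPlane) ∩ frontier K = {c, d} ∧
      a ∈ frontier K ∧ b ∈ frontier K ∧ c ∈ frontier K ∧ d ∈ frontier K ∧
      [a, b, c, d].Nodup ∧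
      ∀ γ : C(unitInterval, EuclPlane),
        a ∈ Set.range γ → b ∈ Set.range γ → c ∈ Set.range γ → d ∈ Set.range γ →
          perimeter K / 2 ≤ pathLength γ := by
  have hdist : ∀ z ∈ K, ∀ w ∈ K, dist z w ≤ 2 * r := fun z hz w hw =>
    hdiam ▸ Metric.dist_le_diam_of_mem hK.isCompact.isBounded hz hw
  -- The disks of radius 2r about a and b meet within this strip.
  have hstrip : ∀ z ∈ K, -r ≤ z 0 ∧ z 0 ≤ r := by
    intro z hz
    have h1 := pow_le_pow_left₀ dist_nonneg (hdist z hz a ha) 2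
    have h2 := pow_le_pow_left₀ dist_nonneg (hdist z hz b hb) 2
    rw [sq_dist_coords, ha0, ha1] at h1
    rw [sq_dist_coords, hb0, hb1] at h2
    constructor <;> nlinarith [sq_nonneg (z 1)]
  have haf : a ∈ frontier K := by
    refine mem_frontier_of_direction (v := !₂[-1, 0]) ha fun ε hε hmem => ?_
    have := (hstrip _ hmem).1
    simp [ha0] at this
    linarith
  have hbf : b ∈ frontier K := by
    refine mem_frontier_of_direction (v := !₂[1, 0]) hb fun ε hε hmem => ?_
    have := (hstrip _ hmem).2
    simp [hb0] at this
    linarith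
  -- An interior point on the axis: it forces c ≠ d and keeps supporting lines at boundary points of
  -- the axis from being vertical.
  obtain ⟨o, ho, ho0⟩ : ∃ o ∈ interior K, o 0 = 0 := by
    obtain ⟨w, hw⟩ := hK.nonempty_interior
    rcases lt_trichotomy (w 0) 0 with h | h | h
    · exact hK.convex.exists_interior_coord_eq_zero hw hb (by rw [hb0]; nlinarith)
    · exact ⟨w, hw, h⟩
    · exact hK.convex.exists_interior_coord_eq_zero hw ha (by rw [ha0]; nlinarith)
  have hoK : o ∈ K := interior_subset ho
  have hsec : IsCompact (K ∩ {z | z 0 = 0}) :=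
    hK.isCompact.inter_right (isClosed_eq (continuous_coord 0) continuous_const)
  obtain ⟨c, ⟨hcK, hc0⟩, hc⟩ := hsec.exists_isMaxOn ⟨o, hoK, ho0⟩ (continuous_coord 1).continuousOn
  obtain ⟨d, ⟨hdK, hd0⟩, hd⟩ := hsec.exists_isMinOn ⟨o, hoK, ho0⟩ (continuous_coord 1).continuousOn
  replace hc0 : c 0 = 0 := hc0
  replace hd0 : d 0 = 0 := hd0
  replace hc : ∀ z ∈ K, z 0 = 0 → z 1 ≤ c 1 := fun z hz hz0 => hc ⟨hz, hz0⟩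
  replace hd : ∀ z ∈ K, z 0 = 0 → d 1 ≤ z 1 := fun z hz hz0 => hd ⟨hz, hz0⟩
  have hcf : c ∈ frontier K := by
    refine mem_frontier_of_direction (v := !₂[0, 1]) hcK fun ε hε hmem => ?_
    have := hc _ hmem (by simp [hc0])
    simp at this
    linarith
  have hdf : d ∈ frontier K := by
    refine mem_frontier_of_direction (v := !₂[0, -1]) hdK fun ε hε hmem => ?_
    have := hd _ hmem (by simp [hd0])
    simp at this
    linarith
  have hmid : midpoint ℝ a b ∈ K :=
    hK.convex.segment_subset ha hb (midpoint_mem_segment a b)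
  have hmid0 : midpoint ℝ a b 0 = 0 := by simp [midpoint_eq_smul_add, ha0, hb0]
  have hmid1 : midpoint ℝ a b 1 = 0 := by simp [midpoint_eq_smul_add, ha1, hb1]
  have hc1 : 0 ≤ c 1 := hmid1 ▸ hc _ hmid hmid0
  have hd1 : d 1 ≤ 0 := hmid1 ▸ hd _ hmid hmid0
  have normal : ∀ z ∈ frontier K, ∃ ν : EuclPlane,
      (∀ w ∈ K, ν 0 * w 0 + ν 1 * w 1 ≤ ν 0 * z 0 + ν 1 * z 1) ∧
      ν 1 * o 1 < ν 0 * z 0 + ν 1 * z 1 := by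
    intro z hz
    obtain ⟨ν, h1, h2⟩ := hK.convex.exists_outer_normal hK.nonempty_interior hz
    simp only [inner_coords] at h1 h2
    exact ⟨ν, h1, by simpa [ho0] using h2 o ho⟩
  have ho1c := hc o hoK ho0
  have ho1d := hd o hoK ho0
  obtain ⟨μ, hμ, hμo⟩ := normal c hcf
  obtain ⟨ν, hν, hνo⟩ := normal d hdf
  simp only [hc0, mul_zero, zero_add] at hμ hμo
  simp only [hd0, mul_zero, zero_add] at hν hνo
  have hμ1 : 0 < μ 1 := by
    by_contra! h
    nlinarith
  have hν1 : ν 1 < 0 := by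
    by_contra! h
    nlinarith
  have hdc : d 1 < c 1 := by
    have : o 1 < c 1 := lt_of_mul_lt_mul_left hμo hμ1.le
    linarith
  have hbis : ∀ z : EuclPlane, z ∈ AffineSubspace.perpBisector a b ↔ z 0 = 0 := by
    intro z
    rw [AffineSubspace.mem_perpBisector_iff_dist_eq, ← sq_eq_sq₀ dist_nonneg dist_nonneg,
      sq_dist_coords, sq_dist_coords, ha0, ha1, hb0, hb1]
    constructor
    · intro h
      have : r * z 0 = 0 := by linarith
      exact (mul_eq_zero.1 this).resolve_left hr.ne'
    · intro h
      rw [h]; ring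
  refine ⟨c, d, ?_, haf, hbf, hcf, hdf, ?_, ?_⟩
  · ext z
    simp only [Set.mem_inter_iff, SetLike.mem_coe, hbis, Set.mem_insert_iff, Set.mem_singleton_iff]
    constructor
    · rintro ⟨hz0, hz⟩
      have hzK : z ∈ K := hK.isCompact.isClosed.frontier_subset hz
      obtain ⟨ξ, hξ, hξo⟩ := normal z hz
      have h1 := hξ c hcK
      have h2 := hξ d hdK
      simp only [hz0, hc0, hd0, mul_zero, zero_add] at h1 h2 hξo
      have h3 := hc z hzK hz0
      have h4 := hd z hzK hz0
      -- On the axis the supporting inequality involves only ξ 1: its sign makes z the lowest or the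
      -- highest point, and zero would contradict the strict inequality at o.
      rcases lt_trichotomy (ξ 1) 0 with h | h | h
      · exact Or.inr (ext_coords (hz0.trans hd0.symm)
          (le_antisymm ((mul_le_mul_left_of_neg h).1 h2) h4))
      · simp [h] at hξo
      · exact Or.inl (ext_coords (hz0.trans hc0.symm) (le_antisymm h3 (le_of_mul_le_mul_left h1 h)))
    · rintro (rfl | rfl)
      · exact ⟨hc0, hcf⟩
      · exact ⟨hd0, hdf⟩
  · have ne : ∀ {z w : EuclPlane}, z 0 ≠ w 0 → z ≠ w := fun h e => h (by rw [e])
    simp only [List.nodup_cons, List.mem_cons, List.not_mem_nil, or_false, not_or,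
      not_false_eq_true, List.nodup_nil, and_true]
    refine ⟨⟨ne ?_, ne ?_, ne ?_⟩, ⟨ne ?_, ne ?_⟩, fun e => hdc.ne (by rw [e])⟩ <;>
      simp only [ha0, hb0, hc0, hd0] <;> intro h <;> linarith
  · rintro γ ⟨ta, hta⟩ ⟨tb, htb⟩ ⟨tc, htc⟩ ⟨td, htd⟩
    have sqrt_abs : ∀ {x : EuclPlane}, x 0 = 0 → dist a x = √(r ^ 2 + x 1 ^ 2) ∧
        dist b x = √(r ^ 2 + x 1 ^ 2) := by
      intro x hx
      rw [dist_eq_sqrt_coords, dist_eq_sqrt_coords, ha0, ha1, hb0, hb1, hx]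
      constructor <;> congr 1 <;> ring
    have hab : dist a b = 2 * r := by
      rw [dist_eq_sqrt_coords, ha0, ha1, hb0, hb1]
      exact (Real.sqrt_eq_iff_mul_self_eq (by positivity) (by positivity)).2 (by ring)
    have hcd : dist c d = c 1 + -d 1 := by
      rw [dist_eq_sqrt_coords, hc0, hd0]
      exact (Real.sqrt_eq_iff_mul_self_eq (by positivity) (by linarith)).2 (by ring)
    have key : perimeter K ≤ ENNReal.ofReal (2 * (√(r ^ 2 + c 1 ^ 2) + √(r ^ 2 + (-d 1) ^ 2) +
        (c 1 + -d 1))) := by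
      have hμa := hμ a ha
      have hμb := hμ b hb
      have hνa := hν a ha
      have hνb := hν b hb
      simp only [ha0, ha1, hb0, hb1, mul_zero, add_zero] at hμa hμb hνa hνb
      -- m and n are the slopes of the supporting lines at c and d; since a and b lie on the inner
      -- side of both, the slope conditions of the trapezoid follow.
      obtain ⟨m, hm⟩ : ∃ m, μ 0 = -(m * μ 1) := ⟨-(μ 0 / μ 1), by field_simp⟩
      obtain ⟨n, hn⟩ : ∃ n, ν 0 = -(n * ν 1) :=
        ⟨-(ν 0 / ν 1), by have := hν1.ne; field_simp⟩
      rw [hm] at hμa hμb hμ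
      rw [hn] at hνa hνb hν
      refine hK.perimeter_le_trapezoid (m := m) (n := n) hr.le ?_ ?_ ?_ ?_
        fun z hz => ⟨(hstrip z hz).1, (hstrip z hz).2, ?_, ?_⟩
      · exact le_of_mul_le_mul_left (by linarith) hμ1
      · exact le_of_mul_le_mul_left (by linarith) hμ1
      · exact (mul_le_mul_left_of_neg hν1).1 (by linarith)
      · exact (mul_le_mul_left_of_neg hν1).1 (by linarith)
      · exact (mul_le_mul_left_of_neg hν1).1 (by linarith [hν z hz])
      · exact le_of_mul_le_mul_left (by linarith [hμ z hz]) hμ1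
    have key2 := hK.perimeter_le_diam
    have hfin : perimeter K ≠ ⊤ := ne_top_of_le_ne_top ENNReal.ofReal_ne_top key
    have hs2 : 1 ≤ √2 := Real.one_le_sqrt.2 (by norm_num)
    replace key := ENNReal.toReal_le_of_le_ofReal
      (mul_nonneg zero_le_two (add_nonneg (by positivity) (by linarith))) key
    replace key2 := ENNReal.toReal_le_of_le_ofReal
      (mul_nonneg (by linarith) Metric.diam_nonneg) key2
    rw [hdiam] at key2
    have hL : perimeter K / 2 = ENNReal.ofReal ((perimeter K).toReal / 2) := by
      rw [ENNReal.ofReal_div_of_pos two_pos, ENNReal.ofReal_toReal hfin, ENNReal.ofReal_ofNat]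
    have hca := hdist a ha c hcK
    have hda := hdist a ha d hdK
    have hcd' := hdist c hcK d hdK
    rw [(sqrt_abs hc0).1] at hca
    rw [(sqrt_abs hd0).1] at hda
    rw [neg_sq] at key
    rw [hcd] at hcd'
    rw [hL]
    subst hta htb htc htd
    refine le_eVariationOn_of_kite (Set.mem_univ ta) (Set.mem_univ tb) (Set.mem_univ tc)
      (Set.mem_univ td) hab (sqrt_abs hc0).1 (sqrt_abs hc0).2 (sqrt_abs hd0).1 (sqrt_abs hd0).2 hcd
      hca hda hcd' (by linarith) ?_ ?_
    -- A kite side no longer than cd calls for the octagon; otherwise replacing cd by that side only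
    -- lengthens p + q + s, and the trapezoid suffices.
    · rcases le_total (√(r ^ 2 + (γ tc) 1 ^ 2)) ((γ tc) 1 + -(γ td) 1) with h | h
      · have := octagon_le_kite (h := -(γ td) 1) (k := (γ tc) 1) hr.le (by linarith)
        rw [neg_sq] at this
        linarith
      · linarith
    · rcases le_total (√(r ^ 2 + (γ td) 1 ^ 2)) ((γ tc) 1 + -(γ td) 1) with h | h
      · have := octagon_le_kite (h := (γ tc) 1) (k := -(γ td) 1) hr.le (by rwa [neg_sq])
        rw [neg_sq] at this
        linarith
      · linarith

end NormalPosition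

/-! ### Reduction to normal position by an isometry -/

section Transfer

theorem exists_affineIsometryEquiv_normal_position (a b : EuclPlane) :
    ∃ ψ : EuclPlane ≃ᵃⁱ[ℝ] EuclPlane, ψ a 0 = -(dist a b / 2) ∧ ψ a 1 = 0 ∧
      ψ b 0 = dist a b / 2 ∧ ψ b 1 = 0 := by
  set e : EuclPlane := !₂[dist a b, 0] with he
  have hnorm : ‖b - a‖ = ‖e‖ := by
    rw [EuclideanSpace.norm_eq e, Fin.sum_univ_two, ← dist_eq_norm, dist_comm]
    simp [he, Real.sqrt_sq dist_nonneg]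
  -- Two vectors of equal norm are swapped by reflection in the hyperplane orthogonal to their
  -- difference; if they coincide this is the identity.
  let R : EuclPlane ≃ₗᵢ[ℝ] EuclPlane := (ℝ ∙ (b - a - e))ᗮ.reflection
  have hR : R (b - a) = e := Submodule.reflection_sub hnorm
  have e1 : -midpoint ℝ a b + a = (-(1 / 2) : ℝ) • (b - a) := by
    rw [midpoint_eq_smul_add, invOf_eq_inv]; module
  have e2 : -midpoint ℝ a b + b = (1 / 2 : ℝ) • (b - a) := by
    rw [midpoint_eq_smul_add, invOf_eq_inv]; module
  refine ⟨(AffineIsometryEquiv.constVAdd ℝ EuclPlane (-midpoint ℝ a b)).trans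
    R.toAffineIsometryEquiv, ?_⟩
  simp only [AffineIsometryEquiv.coe_trans, Function.comp_apply,
    AffineIsometryEquiv.coe_constVAdd, vadd_eq_add, LinearIsometryEquiv.coe_toAffineIsometryEquiv,
    e1, e2, map_smul, hR]
  simp [he]
  ring

end Transfer

theorem theorem1 (K : Set EuclPlane) (hK : IsConvexShape K) :
    (∃ a b : EuclPlane, IsDiameterOf K a b) ∧
    ∀ a b : EuclPlane, IsDiameterOf K a b →
      ∃ c d : EuclPlane,
        (AffineSubspace.perpBisector a b : Set EuclPlane) ∩ frontier K = {c, d} ∧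
        a ∈ frontier K ∧ b ∈ frontier K ∧ c ∈ frontier K ∧ d ∈ frontier K ∧
        [a, b, c, d].Nodup ∧
        ∀ γ : C(unitInterval, EuclPlane),
          a ∈ Set.range γ → b ∈ Set.range γ → c ∈ Set.range γ → d ∈ Set.range γ →
            perimeter K / 2 ≤ pathLength γ := by
  have hne : K.Nonempty := hK.nonempty_interior.mono interior_subset
  refine ⟨?_, ?_⟩
  · obtain ⟨⟨a, b⟩, ⟨ha, hb⟩, hab⟩ := (hK.isCompact.prod hK.isCompact).exists_isMaxOn
      (hne.prod hne) continuous_dist.continuousOn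
    have hmax : ∀ x ∈ K, ∀ y ∈ K, dist x y ≤ dist a b := fun x hx y hy =>
      isMaxOn_iff.1 hab (x, y) ⟨hx, hy⟩
    exact ⟨a, b, ha, hb, le_antisymm (Metric.dist_le_diam_of_mem hK.isCompact.isBounded ha hb)
      (Metric.diam_le_of_forall_dist_le dist_nonneg hmax)⟩
  · rintro a b ⟨ha, hb, hab⟩
    have hpos : 0 < dist a b := by
      refine dist_pos.2 fun e => ?_
      have hsub : K ⊆ {a} := fun z hz => by
        have h := Metric.dist_le_diam_of_mem hK.isCompact.isBounded hz ha
        rw [← hab, e, dist_self] at h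
        simpa [e] using dist_le_zero.1 h
      obtain ⟨w, hw⟩ := hK.nonempty_interior
      simpa using interior_mono hsub hw
    obtain ⟨ψ, hψa0, hψa1, hψb0, hψb1⟩ := exists_affineIsometryEquiv_normal_position a b
    have hfr : frontier (ψ '' K) = ψ '' frontier K := (ψ.toHomeomorph.image_frontier K).symm
    have hin : interior (ψ '' K) = ψ '' interior K := (ψ.toHomeomorph.image_interior K).symm
    have hK' : IsConvexShape (ψ '' K) :=
      ⟨hK.isCompact.image ψ.continuous, hK.convex.affine_image ψ.toAffineEquiv.toAffineMap,
        hin ▸ hK.nonempty_interior.image ψ⟩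
    have hper : perimeter (ψ '' K) = perimeter K := by
      rw [perimeter, hfr]
      exact ψ.toIsometryEquiv.hausdorffMeasure_image 1 (frontier K)
    obtain ⟨c, d, hcd, haf, hbf, hcf, hdf, hnodup, hpath⟩ :=
      hK'.exists_kite_of_normal_position (half_pos hpos) (Set.mem_image_of_mem ψ ha)
        (Set.mem_image_of_mem ψ hb) (by rw [ψ.isometry.diam_image, ← hab]; ring)
        hψa0 hψa1 hψb0 hψb1
    obtain ⟨c, rfl⟩ := ψ.surjective c
    obtain ⟨d, rfl⟩ := ψ.surjective d
    rw [hfr] at hcd haf hbf hcf hdf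
    rw [ψ.injective.mem_set_image] at haf hbf hcf hdf
    refine ⟨c, d, ?_, haf, hbf, hcf, hdf, ?_, ?_⟩
    · ext z
      have h := Set.ext_iff.1 hcd (ψ z)
      simpa only [Set.mem_inter_iff, SetLike.mem_coe, ψ.injective.mem_set_image,
        AffineSubspace.mem_perpBisector_iff_dist_eq, ψ.dist_map, Set.mem_insert_iff,
        Set.mem_singleton_iff, ψ.injective.eq_iff] using h
    · exact List.Nodup.of_map ψ hnodup
    · rintro γ ⟨ta, rfl⟩ ⟨tb, rfl⟩ ⟨tc, rfl⟩ ⟨td, rfl⟩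
      have h := hpath ((ψ.toHomeomorph : C(EuclPlane, EuclPlane)).comp γ)
        ⟨ta, rfl⟩ ⟨tb, rfl⟩ ⟨tc, rfl⟩ ⟨td, rfl⟩
      rw [hper] at h
      refine h.trans (le_of_eq ?_)
      exact iSup_congr fun u => Finset.sum_congr rfl fun i _ => ψ.isometry.edist_eq _ _
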